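/- Let $\mathcal H$ be a complex separable Hilbert space (finite- or infinite-dimensional) with $\dim\mathcal H\ge 2$. Let $\mathcal T(\mathcal H)$ be the space of trace class operators on $\mathcal H$ with the trace norm $\|X\|_1=\mathrm{tr}\,|X|$, where $|X|=(X^*X)^{1/2}$, let $\mathcal B(\mathcal H\otimes\mathcal H)$ be the space of bounded operators on the Hilbert space tensor product $\mathcal H\otimes\mathcal H$ with the operator norm, let $I$ be the identity operator on $\mathcal H$, and let $S\in\mathcal B(\mathcal H\otimes\mathcal H)$ be the swap operator, $S(x\otimes y)=y\otimes x$ for $x,y\in\mathcal H$. Let $\Phi:(\mathcal T(\mathcal H),\|\cdot\|_1)\to(\mathcal B(\mathcal H\otimes\mathcal H),\|\cdot\|)$ be a continuous linear map. Call $\Phi$ covariant under unitary evolution if $$\Phi(UXU^*)=(U\otimes U)\,\Phi(X)\,(U^*\otimes U^*)$$ for all $X\in\mathcal T(\mathcal H)$ and all unitary operators $U$ on $\mathcal H$. Then: 1. $\Phi$ is covariant under unitary evolution if and only if there exist complex numbers $\lambda_1,\dots,\lambda_6$ such that, for all $X\in\mathcal T(\mathcal H)$, $$\Phi(X)=\lambda_1\,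 I\otimes X+\lambda_2\, X\otimes I+\lambda_3\, S(I\otimes X)+\lambda_4\, S(X\otimes I)+\lambda_5\,\mathrm{tr}(X)\, I\otimes I+\lambda_6\,\mathrm{tr}(X)\, S.\qquad(*)$$ 2. If $\dim\mathcal H\ge 3$ and $\Phi$ is covariant under unitary evolution, then the coefficients $(\lambda_1,\dots,\lambda_6)$ in $(*)$ are unique. 3. If $\dim\mathcal H=2$ and $\Phi$ is covariant under unitary evolution, then the coefficients in $(*)$ are not unique: at least two different $6$-tuples $(\lambda_1,\dots,\lambda_6)$ satisfy $(*)$. -/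

import Mathlib

open scoped TensorProduct InnerProductSpace ENNReal

noncomputable section

namespace UnitaryCovariance

/-! ### The trace norm and the trace -/

section TraceNorm

set_option linter.unusedSectionVars false

variable {H : Type*} [NormedAddCommGroup H] [InnerProductSpace ℂ H] [CompleteSpace H]

variable (H) in
/-- The index set of a fixed Hilbert basis of `H`. The trace norm and the trace are defined with
this basis; `traceNorm_eq_tsum` and `TraceClass.hasSum_trace` show that every Hilbert basis gives
the same values. -/
def basisSet : Set H := (exists_hilbertBasis ℂ H).choose

variable (H) in
/-- A fixed Hilbert basis of `H`. -/
def stdBasis : HilbertBasis (basisSet H) ℂ H := (exists_hilbertBasis ℂ H).choose_spec.choose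

/-- The trace norm `tr |A|`, where `|A| = (A⋆ A)^{1/2}`, as an extended nonnegative real. -/
def traceNorm (A : H →L[ℂ] H) : ℝ≥0∞ :=
  ∑' i, ENNReal.ofReal (⟪stdBasis H i, CFC.abs A (stdBasis H i)⟫_ℂ).re

/-- An operator is of trace class if `tr |A|` is finite. -/
def IsTraceClass (A : H →L[ℂ] H) : Prop := traceNorm A ≠ ∞

/-- The squared Hilbert-Schmidt norm. -/
def hs {ι : Type*} (b : HilbertBasis ι ℂ H) (T : H →L[ℂ] H) : ℝ≥0∞ :=
  ∑' i, ‖T (b i)‖ₑ ^ 2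

theorem parseval {ι : Type*} (b : HilbertBasis ι ℂ H) (x : H) :
    ‖x‖ₑ ^ 2 = ∑' i, ‖⟪b i, x⟫_ℂ‖ₑ ^ 2 := by
  have h := (b.hasSum_inner_mul_inner x x).mapL Complex.reCLM
  have h2 : HasSum (fun i => ‖⟪b i, x⟫_ℂ‖ ^ 2) (‖x‖ ^ 2) := by
    convert h using 1
    · ext i
      rw [← inner_conj_symm x (b i), ← Complex.normSq_eq_conj_mul_self, Complex.normSq_eq_norm_sq]
      simp [-Complex.ofReal_pow]
    · rw [inner_self_eq_norm_sq_to_K]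
      simp [← Complex.ofReal_pow]
  have e : ∀ y : H, ‖y‖ₑ ^ 2 = ENNReal.ofReal (‖y‖ ^ 2) := fun y => by
    rw [ENNReal.ofReal_pow (norm_nonneg _), ofReal_norm]
  have e' : ∀ y : ℂ, ‖y‖ₑ ^ 2 = ENNReal.ofReal (‖y‖ ^ 2) := fun y => by
    rw [ENNReal.ofReal_pow (norm_nonneg _), ofReal_norm]
  rw [e, ← h2.tsum_eq, ENNReal.ofReal_tsum_of_nonneg (fun i => by positivity) h2.summable]
  simp_rw [e']

theorem hs_adjoint {ι κ : Type*} (b : HilbertBasis ι ℂ H) (c : HilbertBasis κ ℂ H)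
    (T : H →L[ℂ] H) : hs b T = hs c (ContinuousLinearMap.adjoint T) := by
  unfold hs
  simp_rw [parseval c (T _), parseval b ((ContinuousLinearMap.adjoint T) _)]
  rw [ENNReal.tsum_comm]
  refine tsum_congr fun j => tsum_congr fun i => ?_
  rw [ContinuousLinearMap.adjoint_inner_right, ← inner_conj_symm, ← ofReal_norm, RCLike.norm_conj,
    ofReal_norm]

theorem hs_basis {ι κ : Type*} (b : HilbertBasis ι ℂ H) (c : HilbertBasis κ ℂ H)
    (T : H →L[ℂ] H) : hs b T = hs c T := by
  rw [hs_adjoint b c, ← hs_adjoint c c]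

theorem hs_comp_left {ι : Type*} (b : HilbertBasis ι ℂ H) {V : H →L[ℂ] H} (hV : ‖V‖ ≤ 1)
    (T : H →L[ℂ] H) : hs b (V ∘L T) ≤ hs b T := by
  refine ENNReal.tsum_le_tsum fun i => ?_
  gcongr
  rw [enorm_le_iff_norm_le]
  exact (V.le_opNorm _).trans (mul_le_of_le_one_left (norm_nonneg _) hV)

theorem hs_comp_right {ι : Type*} (b : HilbertBasis ι ℂ H) {V : H →L[ℂ] H} (hV : ‖V‖ ≤ 1)
    (T : H →L[ℂ] H) : hs b (T ∘L V) ≤ hs b T := by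
  rw [hs_adjoint b b, ContinuousLinearMap.adjoint_comp, hs_adjoint b b T]
  exact hs_comp_left b (by simpa using hV) _

theorem adjoint_of_nonneg {T : H →L[ℂ] H} (hT : 0 ≤ T) :
    ContinuousLinearMap.adjoint T = T :=
  (IsSelfAdjoint.of_nonneg hT).star_eq

theorem ofReal_inner_of_nonneg {T : H →L[ℂ] H} (hT : 0 ≤ T) (x : H) :
    ENNReal.ofReal (⟪x, T x⟫_ℂ).re = ‖CFC.sqrt T x‖ₑ ^ 2 := by
  have hR : ContinuousLinearMap.adjoint (CFC.sqrt T) = CFC.sqrt T :=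
    adjoint_of_nonneg (CFC.sqrt_nonneg T)
  have hTR : T x = CFC.sqrt T (CFC.sqrt T x) :=
    (congrArg (fun A : H →L[ℂ] H => A x) (CFC.sqrt_mul_sqrt_self T hT)).symm
  have h : ⟪x, T x⟫_ℂ = ⟪CFC.sqrt T x, CFC.sqrt T x⟫_ℂ := by
    rw [hTR, ← ContinuousLinearMap.adjoint_inner_left, hR]
  have h2 : (⟪CFC.sqrt T x, CFC.sqrt T x⟫_ℂ).re = ‖CFC.sqrt T x‖ ^ 2 :=
    (norm_sq_eq_re_inner (𝕜 := ℂ) (CFC.sqrt T x)).symm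
  rw [h, h2, ENNReal.ofReal_pow (norm_nonneg _), ofReal_norm]

theorem traceNorm_eq_hs (A : H →L[ℂ] H) :
    traceNorm A = hs (stdBasis H) (CFC.sqrt (CFC.abs A)) :=
  tsum_congr fun _ => ofReal_inner_of_nonneg (CFC.abs_nonneg A) _

/-- The trace norm may be computed with any Hilbert basis. -/
theorem traceNorm_eq_tsum {ι : Type*} (b : HilbertBasis ι ℂ H) (A : H →L[ℂ] H) :
    traceNorm A = ∑' i, ENNReal.ofReal (⟪b i, CFC.abs A (b i)⟫_ℂ).re := by
  rw [traceNorm_eq_hs, hs_basis _ b, hs]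
  exact tsum_congr fun i => (ofReal_inner_of_nonneg (CFC.abs_nonneg A) _).symm

theorem inner_abs_abs (A : H →L[ℂ] H) (x y : H) :
    ⟪CFC.abs A x, CFC.abs A y⟫_ℂ = ⟪A x, A y⟫_ℂ := by
  rw [← ContinuousLinearMap.adjoint_inner_right, adjoint_of_nonneg (CFC.abs_nonneg A),
    ← mul_apply_eq_comp, CFC.abs_mul_abs, ContinuousLinearMap.star_eq_adjoint,
    mul_apply_eq_comp, ContinuousLinearMap.adjoint_inner_right]

theorem norm_abs_apply (A : H →L[ℂ] H) (x : H) : ‖CFC.abs A x‖ = ‖A x‖ := by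
  have h := inner_abs_abs A x x
  rw [inner_self_eq_norm_sq_to_K, inner_self_eq_norm_sq_to_K] at h
  have h' : ‖CFC.abs A x‖ ^ 2 = ‖A x‖ ^ 2 := by exact_mod_cast h
  exact (sq_eq_sq₀ (norm_nonneg _) (norm_nonneg _)).1 h'

/-- Polar decomposition. -/
theorem exists_polar (A : H →L[ℂ] H) : ∃ W : H →L[ℂ] H, ‖W‖ ≤ 1 ∧
    W ∘L CFC.abs A = A ∧ ContinuousLinearMap.adjoint W ∘L A = CFC.abs A := by
  set R := CFC.abs A with hR
  set K : Submodule ℂ H := (LinearMap.range (R : H →ₗ[ℂ] H)).topologicalClosure with hK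
  have hKc : IsClosed (K : Set H) := Submodule.isClosed_topologicalClosure _
  have : CompleteSpace K := hKc.completeSpace_coe
  have hmem : ∀ x, R x ∈ K := fun x =>
    Submodule.le_topologicalClosure _ (LinearMap.mem_range_self _ x)
  let e : H →ₗ[ℂ] K := (R : H →ₗ[ℂ] H).codRestrict K hmem
  have he : DenseRange e := by
    intro k
    rw [closure_subtype]
    have h1 : ((↑) : K → H) '' (Set.range e) = (LinearMap.range (R : H →ₗ[ℂ] H) : Set H) := by
      ext y; simp [e]
    rw [h1]
    exact k.2
  have hn : ∀ x, ‖(A : H →ₗ[ℂ] H) x‖ ≤ 1 * ‖e x‖ := fun x => by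
    rw [one_mul]; exact (norm_abs_apply A x).ge
  let W₀ : K →L[ℂ] H := (A : H →ₗ[ℂ] H).extendOfNorm e
  have hW₀ : ∀ x, W₀ (e x) = A x := LinearMap.extendOfNorm_eq he ⟨1, hn⟩
  have hW₀n : ‖W₀‖ ≤ 1 := LinearMap.opNorm_extendOfNorm_le he zero_le_one hn
  let P : H →L[ℂ] K := K.orthogonalProjectionOnto
  have hPe : ∀ x, P (R x) = e x := fun x =>
    Submodule.orthogonalProjectionOnto_mem_subspace_eq_self (e x)
  refine ⟨W₀ ∘L P, ?_, ?_, ?_⟩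
  · refine (ContinuousLinearMap.opNorm_comp_le _ _).trans ?_
    exact mul_le_one₀ hW₀n (norm_nonneg _) K.orthogonalProjectionOnto_norm_le
  · ext x
    simp [hPe, hW₀]
  · have key : ∀ (x : H) (k : K), ⟪A x, W₀ k⟫_ℂ = ⟪R x, (k : H)⟫_ℂ := fun x k => by
      refine he.induction_on k (isClosed_eq (by fun_prop) (by fun_prop)) fun z => ?_
      rw [hW₀]
      exact (inner_abs_abs A x z).symm
    ext x
    refine ext_inner_right ℂ fun y => ?_
    rw [ContinuousLinearMap.comp_apply, ContinuousLinearMap.adjoint_inner_left,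
      ContinuousLinearMap.comp_apply, key]
    exact Submodule.inner_orthogonalProjectionOnto_eq_of_mem_left (K := K) (e x) y

/-- A factorization of `A` into two operators whose Hilbert-Schmidt norms are controlled by the
trace norm. -/
theorem exists_factor (A : H →L[ℂ] H) : ∃ B C : H →L[ℂ] H,
    A = ContinuousLinearMap.adjoint B ∘L C ∧
    hs (stdBasis H) B ≤ traceNorm A ∧ hs (stdBasis H) C ≤ traceNorm A := by
  obtain ⟨W, hW, hWA, -⟩ := exists_polar A
  refine ⟨ContinuousLinearMap.adjoint (W ∘L CFC.sqrt (CFC.abs A)), CFC.sqrt (CFC.abs A), ?_, ?_, ?_⟩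
  · rw [ContinuousLinearMap.adjoint_adjoint, ContinuousLinearMap.comp_assoc]
    conv_lhs => rw [← hWA, ← CFC.sqrt_mul_sqrt_self (CFC.abs A) (CFC.abs_nonneg A)]
    rfl
  · rw [← hs_adjoint (stdBasis H), traceNorm_eq_hs]
    exact hs_comp_left _ hW _
  · rw [traceNorm_eq_hs]

theorem enorm_inner_le (x y : H) : ‖⟪x, y⟫_ℂ‖ₑ ≤ 2⁻¹ * (‖x‖ₑ ^ 2 + ‖y‖ₑ ^ 2) := by
  have h : ‖⟪x, y⟫_ℂ‖ ≤ 2⁻¹ * (‖x‖ ^ 2 + ‖y‖ ^ 2) :=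
    (norm_inner_le_norm x y).trans (by nlinarith [sq_nonneg (‖x‖ - ‖y‖)])
  have h2 := ENNReal.ofReal_le_ofReal h
  rw [ENNReal.ofReal_mul (by norm_num), ENNReal.ofReal_add (by positivity) (by positivity),
    ENNReal.ofReal_pow (norm_nonneg _), ENNReal.ofReal_pow (norm_nonneg _), ofReal_norm,
    ofReal_norm, ofReal_norm, ENNReal.ofReal_inv_of_pos (by norm_num), ENNReal.ofReal_ofNat] at h2
  exact h2

theorem tsum_inner_le {ι : Type*} (b : HilbertBasis ι ℂ H) (A : H →L[ℂ] H)
    {V T : H →L[ℂ] H} (hV : ‖V‖ ≤ 1) (hT : ‖T‖ ≤ 1) :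
    ∑' i, ‖⟪V (b i), A (T (b i))⟫_ℂ‖ₑ ≤ traceNorm A := by
  obtain ⟨B, C, hA, hB, hC⟩ := exists_factor A
  have h2 : (2⁻¹ : ℝ≥0∞) * (traceNorm A + traceNorm A) = traceNorm A := by
    rw [← two_mul, ← mul_assoc, ENNReal.inv_mul_cancel (by norm_num) (by norm_num), one_mul]
  calc ∑' i, ‖⟪V (b i), A (T (b i))⟫_ℂ‖ₑ
      = ∑' i, ‖⟪(B ∘L V) (b i), (C ∘L T) (b i)⟫_ℂ‖ₑ := by
        refine tsum_congr fun i => ?_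
        conv_lhs => rw [hA]
        rw [ContinuousLinearMap.comp_apply, ContinuousLinearMap.adjoint_inner_right]
        rfl
    _ ≤ ∑' i, 2⁻¹ * (‖(B ∘L V) (b i)‖ₑ ^ 2 + ‖(C ∘L T) (b i)‖ₑ ^ 2) :=
        ENNReal.tsum_le_tsum fun i => enorm_inner_le _ _
    _ = 2⁻¹ * (hs b (B ∘L V) + hs b (C ∘L T)) := by
        rw [ENNReal.tsum_mul_left, ENNReal.tsum_add]; rfl
    _ ≤ 2⁻¹ * (traceNorm A + traceNorm A) := by
        rw [← hs_basis (stdBasis H) b, ← hs_basis (stdBasis H) b]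
        gcongr
        · exact (hs_comp_right _ hV _).trans hB
        · exact (hs_comp_right _ hT _).trans hC
    _ = traceNorm A := h2

theorem traceNorm_le_of_polar (A : H →L[ℂ] H) : ∃ W : H →L[ℂ] H, ‖W‖ ≤ 1 ∧
    traceNorm A ≤ ∑' i, ‖⟪W (stdBasis H i), A (stdBasis H i)⟫_ℂ‖ₑ := by
  obtain ⟨W, hW, -, hWA⟩ := exists_polar A
  refine ⟨W, hW, ENNReal.tsum_le_tsum fun i => ?_⟩
  rw [← hWA, ContinuousLinearMap.comp_apply, ContinuousLinearMap.adjoint_inner_right, ← ofReal_norm]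
  exact ENNReal.ofReal_le_ofReal (Complex.re_le_norm _)

theorem traceNorm_add_le (A B : H →L[ℂ] H) : traceNorm (A + B) ≤ traceNorm A + traceNorm B := by
  obtain ⟨W, hW, h⟩ := traceNorm_le_of_polar (A + B)
  have h1 : ‖(1 : H →L[ℂ] H)‖ ≤ 1 := ContinuousLinearMap.norm_id_le
  refine h.trans (le_trans ?_ (add_le_add (tsum_inner_le (stdBasis H) A hW h1)
    (tsum_inner_le (stdBasis H) B hW h1)))
  rw [← ENNReal.tsum_add]
  refine ENNReal.tsum_le_tsum fun i => ?_
  rw [add_apply, inner_add_right]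
  exact enorm_add_le _ _

theorem traceNorm_smul (c : ℂ) (A : H →L[ℂ] H) : traceNorm (c • A) = ‖c‖ₑ * traceNorm A := by
  unfold traceNorm
  rw [← ENNReal.tsum_mul_left]
  refine tsum_congr fun i => ?_
  rw [CFC.abs_smul, ← ofReal_norm, ← ENNReal.ofReal_mul (norm_nonneg _)]
  congr 1
  simp [inner_smul_right_eq_smul]

theorem traceNorm_eq_zero {A : H →L[ℂ] H} (h : traceNorm A = 0) : A = 0 := by
  rw [traceNorm_eq_hs, hs, ENNReal.tsum_eq_zero] at h
  have h0 : CFC.sqrt (CFC.abs A) = 0 := by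
    ext x
    have hx := ((stdBasis H).hasSum_repr x).mapL (CFC.sqrt (CFC.abs A))
    refine hx.unique ?_
    have hz : ∀ i, CFC.sqrt (CFC.abs A) ((stdBasis H).repr x i • stdBasis H i) = 0 := fun i => by
      have := h i
      simp only [ne_eq, OfNat.ofNat_ne_zero, not_false_eq_true, pow_eq_zero_iff,
        enorm_eq_zero] at this
      rw [map_smul, this, smul_zero]
    simp only [hz]
    exact hasSum_zero
  rwa [CFC.sqrt_eq_zero_iff _ (CFC.abs_nonneg A), CFC.abs_eq_zero_iff] at h0

theorem traceNorm_zero : traceNorm (0 : H →L[ℂ] H) = 0 := by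
  simpa using traceNorm_smul (0 : ℂ) (0 : H →L[ℂ] H)

theorem traceNorm_conj_le {V T : H →L[ℂ] H} (hV : ‖V‖ ≤ 1) (hT : ‖T‖ ≤ 1) (A : H →L[ℂ] H) :
    traceNorm (V * A * T) ≤ traceNorm A := by
  obtain ⟨W, hW, h⟩ := traceNorm_le_of_polar (V * A * T)
  refine h.trans (le_trans (le_of_eq ?_) (tsum_inner_le (stdBasis H) A
    (V := ContinuousLinearMap.adjoint V ∘L W) ?_ hT))
  · refine tsum_congr fun i => ?_
    rw [ContinuousLinearMap.comp_apply, ContinuousLinearMap.adjoint_inner_left]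
    rfl
  · refine (ContinuousLinearMap.opNorm_comp_le _ _).trans ?_
    exact mul_le_one₀ (by simpa using hV) (norm_nonneg _) hW

theorem norm_le_one_of_mem_unitary {U : H →L[ℂ] H} (hU : U ∈ unitary (H →L[ℂ] H)) : ‖U‖ ≤ 1 := by
  refine U.opNorm_le_bound zero_le_one fun x => ?_
  rw [one_mul]
  exact ((ContinuousLinearMap.norm_map_iff_adjoint_comp_self U).2 hU.1 x).le

end TraceNorm

/-! ### The Banach space of trace class operators -/

section TraceClass

/-- The trace class operators, as a linear subspace of the bounded operators. -/
def traceClassSubmodule (H : Type*) [NormedAddCommGroup H] [InnerProductSpace ℂ H]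
    [CompleteSpace H] : Submodule ℂ (H →L[ℂ] H) where
  carrier := {A | IsTraceClass A}
  add_mem' {A B} hA hB :=
    ne_top_of_le_ne_top (ENNReal.add_ne_top.2 ⟨hA, hB⟩) (traceNorm_add_le A B)
  zero_mem' := by simp [IsTraceClass, traceNorm_zero]
  smul_mem' c A hA := by
    simp only [Set.mem_ofPred_eq, IsTraceClass, traceNorm_smul] at hA ⊢
    exact ENNReal.mul_ne_top enorm_ne_top hA

/-- The space `T(H)` of trace class operators. It is a separate type so that it carries the trace
norm and not the operator norm. -/
def TraceClass (H : Type*) [NormedAddCommGroup H] [InnerProductSpace ℂ H] [CompleteSpace H] :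
    Type _ := traceClassSubmodule H

namespace TraceClass

variable {H : Type*} [NormedAddCommGroup H] [InnerProductSpace ℂ H] [CompleteSpace H]

instance : AddCommGroup (TraceClass H) := inferInstanceAs (AddCommGroup (traceClassSubmodule H))

instance : Module ℂ (TraceClass H) := inferInstanceAs (Module ℂ (traceClassSubmodule H))

/-- The inclusion of the trace class operators into the bounded operators. -/
def toCLM : TraceClass H →ₗ[ℂ] (H →L[ℂ] H) := (traceClassSubmodule H).subtype

theorem toCLM_injective : Function.Injective (toCLM : TraceClass H → (H →L[ℂ] H)) :=
  Subtype.val_injective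

theorem isTraceClass (X : TraceClass H) : IsTraceClass (toCLM X) := X.2

/-- The trace norm `‖X‖₁ = tr |X|`. -/
instance : Norm (TraceClass H) := ⟨fun X => (traceNorm (toCLM X)).toReal⟩

theorem norm_def (X : TraceClass H) : ‖X‖ = (traceNorm (toCLM X)).toReal := rfl

theorem normCore : NormedSpace.Core ℂ (TraceClass H) where
  norm_nonneg X := ENNReal.toReal_nonneg
  norm_smul c X := by
    simp [norm_def, traceNorm_smul]
  norm_triangle X Y := by
    rw [norm_def, norm_def, norm_def, map_add,
      ← ENNReal.toReal_add (isTraceClass X) (isTraceClass Y)]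
    exact ENNReal.toReal_mono (ENNReal.add_ne_top.2 ⟨isTraceClass X, isTraceClass Y⟩)
      (traceNorm_add_le _ _)
  norm_eq_zero_iff X := by
    rw [norm_def, ENNReal.toReal_eq_zero_iff, or_iff_left (isTraceClass X)]
    refine ⟨fun h => toCLM_injective ?_, fun h => ?_⟩
    · rw [traceNorm_eq_zero h, map_zero]
    · rw [h, map_zero, traceNorm_zero]

instance : NormedAddCommGroup (TraceClass H) := NormedAddCommGroup.ofCore normCore

instance : NormedSpace ℂ (TraceClass H) := NormedSpace.ofCore normCore

/-- The trace `tr X = ∑ᵢ ⟨eᵢ, X eᵢ⟩`. -/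
def trace (X : TraceClass H) : ℂ := ∑' i, ⟪stdBasis H i, toCLM X (stdBasis H i)⟫_ℂ

theorem tsum_inner_comm {ι κ : Type*} (c : HilbertBasis ι ℂ H) (d : HilbertBasis κ ℂ H)
    {B C : H →L[ℂ] H} (hB : hs c B ≠ ∞) (hC : hs c C ≠ ∞) :
    ∑' i, ⟪B (c i), C (c i)⟫_ℂ =
      ∑' j, ⟪ContinuousLinearMap.adjoint C (d j), ContinuousLinearMap.adjoint B (d j)⟫_ℂ := by
  have hsum : Summable (Function.uncurry fun i j => ⟪B (c i), d j⟫_ℂ * ⟪d j, C (c i)⟫_ℂ) := by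
    refine Summable.of_enorm (ne_top_of_le_ne_top (ENNReal.add_ne_top.2 ⟨hB, hC⟩) ?_)
    rw [ENNReal.tsum_prod', hs, hs, ← ENNReal.tsum_add]
    refine ENNReal.tsum_le_tsum fun i => ?_
    rw [parseval d, parseval d, ← ENNReal.tsum_add]
    refine ENNReal.tsum_le_tsum fun j => ?_
    have hc : ‖⟪B (c i), d j⟫_ℂ‖ₑ = ‖⟪d j, B (c i)⟫_ℂ‖ₑ := by
      rw [← inner_conj_symm, ← ofReal_norm, RCLike.norm_conj, ofReal_norm]
    rw [Function.uncurry_apply_pair, enorm_mul, hc]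
    rcases le_total ‖⟪d j, B (c i)⟫_ℂ‖ₑ ‖⟪d j, C (c i)⟫_ℂ‖ₑ with h | h
    · exact le_add_left ((mul_le_mul_left h _).trans_eq (sq _).symm)
    · exact le_add_right ((mul_le_mul_right h _).trans_eq (sq _).symm)
  calc ∑' i, ⟪B (c i), C (c i)⟫_ℂ = ∑' i, ∑' j, ⟪B (c i), d j⟫_ℂ * ⟪d j, C (c i)⟫_ℂ :=
        tsum_congr fun i => (d.tsum_inner_mul_inner _ _).symm
    _ = ∑' j, ∑' i, ⟪B (c i), d j⟫_ℂ * ⟪d j, C (c i)⟫_ℂ := hsum.tsum_comm.symm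
    _ = _ := by
        refine tsum_congr fun j => ?_
        rw [← c.tsum_inner_mul_inner]
        refine tsum_congr fun i => ?_
        rw [ContinuousLinearMap.adjoint_inner_left, ContinuousLinearMap.adjoint_inner_right,
          mul_comm]

/-- The trace may be computed with any Hilbert basis, and the series converges. -/
theorem hasSum_trace {ι : Type*} (b : HilbertBasis ι ℂ H) (X : TraceClass H) :
    HasSum (fun i => ⟪b i, toCLM X (b i)⟫_ℂ) (trace X) := by
  obtain ⟨B, C, hX, hB, hC⟩ := exists_factor (toCLM X)
  have hB' := ne_top_of_le_ne_top (isTraceClass X) hB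
  have hC' := ne_top_of_le_ne_top (isTraceClass X) hC
  have h1 : ‖(1 : H →L[ℂ] H)‖ ≤ 1 := ContinuousLinearMap.norm_id_le
  have h := (Summable.of_enorm
    (ne_top_of_le_ne_top (isTraceClass X) (tsum_inner_le b (toCLM X) h1 h1))).hasSum
  have e : ∀ x, ⟪x, toCLM X x⟫_ℂ = ⟪B x, C x⟫_ℂ := fun x => by
    rw [hX, ContinuousLinearMap.comp_apply, ContinuousLinearMap.adjoint_inner_right]
  have key : trace X = ∑' i, ⟪b i, toCLM X (b i)⟫_ℂ := by
    simp only [trace, e]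
    rw [tsum_inner_comm (stdBasis H) b hB' hC',
      ← tsum_inner_comm b b (by rwa [hs_basis b (stdBasis H)]) (by rwa [hs_basis b (stdBasis H)])]
  rw [key]
  exact h

/-- The conjugate `U X U⋆` of a trace class operator by a unitary operator. -/
def conj (U : unitary (H →L[ℂ] H)) (X : TraceClass H) : TraceClass H :=
  ⟨(U : H →L[ℂ] H) * toCLM X * star (U : H →L[ℂ] H),
    ne_top_of_le_ne_top (isTraceClass X) (traceNorm_conj_le (norm_le_one_of_mem_unitary U.2)
      (norm_le_one_of_mem_unitary (star U).2) _)⟩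

theorem toCLM_conj (U : unitary (H →L[ℂ] H)) (X : TraceClass H) :
    toCLM (conj U X) = (U : H →L[ℂ] H) * toCLM X * star (U : H →L[ℂ] H) := rfl

end TraceClass

end TraceClass

/-! ### The Hilbert space tensor square -/

section Tensor

/-- The Hilbert space `H ⊗ H`: the completion of the algebraic tensor product for the inner product
`⟨a ⊗ b, c ⊗ d⟩ = ⟨a, c⟩ ⟨b, d⟩`. -/
abbrev HilbertTensor (H : Type*) [NormedAddCommGroup H] [InnerProductSpace ℂ H] : Type _ :=
  UniformSpace.Completion (H ⊗[ℂ] H)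

variable {H : Type*} [NormedAddCommGroup H] [InnerProductSpace ℂ H]

/-- The bounded operator `A ⊗ B` on `H ⊗ H`. -/
def tensorOp (A B : H →L[ℂ] H) : HilbertTensor H →L[ℂ] HilbertTensor H :=
  (TensorProduct.mapL A B).completion

theorem tensorOp_tmul (A B : H →L[ℂ] H) (x y : H) :
    tensorOp A B ((x ⊗ₜ[ℂ] y : H ⊗[ℂ] H) : HilbertTensor H) =
      ((A x ⊗ₜ[ℂ] B y : H ⊗[ℂ] H) : HilbertTensor H) := by
  rw [tensorOp, ContinuousLinearMap.completion_apply_coe, TensorProduct.mapL_tmul]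

variable (H) in
/-- The swap operator `S` on `H ⊗ H`, with `S (x ⊗ y) = y ⊗ x`. -/
def swap : HilbertTensor H →L[ℂ] HilbertTensor H :=
  ((TensorProduct.commIsometry ℂ H H).toContinuousLinearEquiv :
    (H ⊗[ℂ] H) →L[ℂ] (H ⊗[ℂ] H)).completion

theorem swap_tmul (x y : H) :
    swap H ((x ⊗ₜ[ℂ] y : H ⊗[ℂ] H) : HilbertTensor H) =
      ((y ⊗ₜ[ℂ] x : H ⊗[ℂ] H) : HilbertTensor H) := by
  rw [swap, ContinuousLinearMap.completion_apply_coe]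
  simp

end Tensor

/-! ### Covariant maps -/

section Covariant

variable {H : Type*} [NormedAddCommGroup H] [InnerProductSpace ℂ H] [CompleteSpace H]

/-- Covariance under unitary evolution: `Φ(U X U⋆) = (U ⊗ U) Φ(X) (U⋆ ⊗ U⋆)` for all trace class
operators `X` and all unitary operators `U`. -/
def IsCovariant (Φ : TraceClass H →L[ℂ] (HilbertTensor H →L[ℂ] HilbertTensor H)) : Prop :=
  ∀ (U : unitary (H →L[ℂ] H)) (X : TraceClass H),
    Φ (TraceClass.conj U X) =
      tensorOp (U : H →L[ℂ] H) (U : H →L[ℂ] H) * Φ X *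
        tensorOp (star (U : H →L[ℂ] H)) (star (U : H →L[ℂ] H))

/-- The operator `c₁ I ⊗ X + c₂ X ⊗ I + c₃ S(I ⊗ X) + c₄ S(X ⊗ I) + c₅ tr(X) I ⊗ I + c₆ tr(X) S`,
where the coefficients are indexed from `0`. -/
def canonicalForm (c : Fin 6 → ℂ) (X : TraceClass H) : HilbertTensor H →L[ℂ] HilbertTensor H :=
  c 0 • tensorOp 1 X.toCLM + c 1 • tensorOp X.toCLM 1 +
    c 2 • (swap H * tensorOp 1 X.toCLM) + c 3 • (swap H * tensorOp X.toCLM 1) +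
    (c 4 * X.trace) • tensorOp 1 1 + (c 5 * X.trace) • swap H

end Covariant

end UnitaryCovariance

end

open scoped TensorProduct InnerProductSpace ENNReal

noncomputable section

namespace UnitaryCovariance

/-! The map is encoded by its matrix elements `⟪y₂ ⊗ y₃, Φ(|x₁⟩⟨y₁|) (x₂ ⊗ x₃)⟫`, linear in the `xᵢ`
and conjugate linear in the `yᵢ`. Covariance says that this form is invariant under the unitary
group. As in the first fundamental theorem of invariant theory, such a form is a combination of the
six products pairing each `yᵢ` with some `xⱼ`, one for each permutation in S₃; these are the matrix
elements of the six terms of `canonicalForm`.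

The group is used only through `1 + (θ - 1)|u⟩⟨u|` with `‖u‖ = ‖θ‖ = 1`. Invariance is then a cubic
polynomial identity in `θ - 1`, whose linear coefficient is the infinitesimal invariance under
`|u⟩⟨u|`; polarization extends it to all `|p⟩⟨q|` (`IsTrisesquilinear.rankOneInvariant`). With an
orthonormal triple, choosing `q` in it trades an argument `xⱼ` for a fixed vector and a factor `⟪yᵢ,
xⱼ⟫`; three trades leave constants. In dimension two the same trades reach only symmetrizations in
two slots, but the full antisymmetrization vanishes, and together these recover the form
(`isContraction_of_span_pair`).

Continuity passes from rank-one operators to all of the trace class, since `X = ∑ |X bᵢ⟩⟨bᵢ|` in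
trace norm. An orthonormal triple separates the six contractions, giving uniqueness; in dimension
two the determinant of the 3 × 3 matrix `⟪yᵢ, xⱼ⟫` vanishes, giving a nontrivial relation. -/

open InnerProductSpace ContinuousLinearMap Filter Topology

/-! ### Infinitesimal invariance extracted from unitary invariance -/

section Trisesquilinear

variable {H : Type*} [NormedAddCommGroup H] [InnerProductSpace ℂ H]

/-- A function of six vectors that is linear in the first three and conjugate linear in the last
three. -/
structure IsTrisesquilinear (f : H → H → H → H → H → H → ℂ) : Prop where
  add₁ : ∀ a b x₂ x₃ y₁ y₂ y₃, f (a + b) x₂ x₃ y₁ y₂ y₃ = f a x₂ x₃ y₁ y₂ y₃ + f b x₂ x₃ y₁ y₂ y₃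
  add₂ : ∀ a b x₁ x₃ y₁ y₂ y₃, f x₁ (a + b) x₃ y₁ y₂ y₃ = f x₁ a x₃ y₁ y₂ y₃ + f x₁ b x₃ y₁ y₂ y₃
  add₃ : ∀ a b x₁ x₂ y₁ y₂ y₃, f x₁ x₂ (a + b) y₁ y₂ y₃ = f x₁ x₂ a y₁ y₂ y₃ + f x₁ x₂ b y₁ y₂ y₃
  add₄ : ∀ a b x₁ x₂ x₃ y₂ y₃, f x₁ x₂ x₃ (a + b) y₂ y₃ = f x₁ x₂ x₃ a y₂ y₃ + f x₁ x₂ x₃ b y₂ y₃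
  add₅ : ∀ a b x₁ x₂ x₃ y₁ y₃, f x₁ x₂ x₃ y₁ (a + b) y₃ = f x₁ x₂ x₃ y₁ a y₃ + f x₁ x₂ x₃ y₁ b y₃
  add₆ : ∀ a b x₁ x₂ x₃ y₁ y₂, f x₁ x₂ x₃ y₁ y₂ (a + b) = f x₁ x₂ x₃ y₁ y₂ a + f x₁ x₂ x₃ y₁ y₂ b
  smul₁ : ∀ (c : ℂ) a x₂ x₃ y₁ y₂ y₃, f (c • a) x₂ x₃ y₁ y₂ y₃ = c * f a x₂ x₃ y₁ y₂ y₃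
  smul₂ : ∀ (c : ℂ) a x₁ x₃ y₁ y₂ y₃, f x₁ (c • a) x₃ y₁ y₂ y₃ = c * f x₁ a x₃ y₁ y₂ y₃
  smul₃ : ∀ (c : ℂ) a x₁ x₂ y₁ y₂ y₃, f x₁ x₂ (c • a) y₁ y₂ y₃ = c * f x₁ x₂ a y₁ y₂ y₃
  smul₄ : ∀ (c : ℂ) a x₁ x₂ x₃ y₂ y₃,
    f x₁ x₂ x₃ (c • a) y₂ y₃ = (starRingEnd ℂ) c * f x₁ x₂ x₃ a y₂ y₃
  smul₅ : ∀ (c : ℂ) a x₁ x₂ x₃ y₁ y₃,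
    f x₁ x₂ x₃ y₁ (c • a) y₃ = (starRingEnd ℂ) c * f x₁ x₂ x₃ y₁ a y₃
  smul₆ : ∀ (c : ℂ) a x₁ x₂ x₃ y₁ y₂,
    f x₁ x₂ x₃ y₁ y₂ (c • a) = (starRingEnd ℂ) c * f x₁ x₂ x₃ y₁ y₂ a

/-- Infinitesimal unitary invariance, polarized to the operators `|p⟩⟨q|`. -/
def IsRankOneInvariant (f : H → H → H → H → H → H → ℂ) : Prop :=
  ∀ p q x₁ x₂ x₃ y₁ y₂ y₃,
    ⟪q, x₁⟫_ℂ * f p x₂ x₃ y₁ y₂ y₃ + ⟪q, x₂⟫_ℂ * f x₁ p x₃ y₁ y₂ y₃ +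
        ⟪q, x₃⟫_ℂ * f x₁ x₂ p y₁ y₂ y₃ =
      ⟪y₁, p⟫_ℂ * f x₁ x₂ x₃ q y₂ y₃ + ⟪y₂, p⟫_ℂ * f x₁ x₂ x₃ y₁ q y₃ +
        ⟪y₃, p⟫_ℂ * f x₁ x₂ x₃ y₁ y₂ q

/-- The linear combination of the six complete contractions of three vectors with three covectors,
in the order of the terms of `canonicalForm`. -/
def contraction (c : Fin 6 → ℂ) (x₁ x₂ x₃ y₁ y₂ y₃ : H) : ℂ :=
  c 0 * (⟪y₂, x₂⟫_ℂ * ⟪y₃, x₁⟫_ℂ * ⟪y₁, x₃⟫_ℂ) + c 1 * (⟪y₃, x₃⟫_ℂ * ⟪y₂, x₁⟫_ℂ * ⟪y₁, x₂⟫_ℂ) +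
  c 2 * (⟪y₂, x₁⟫_ℂ * ⟪y₃, x₂⟫_ℂ * ⟪y₁, x₃⟫_ℂ) + c 3 * (⟪y₂, x₃⟫_ℂ * ⟪y₃, x₁⟫_ℂ * ⟪y₁, x₂⟫_ℂ) +
  c 4 * (⟪y₁, x₁⟫_ℂ * ⟪y₂, x₂⟫_ℂ * ⟪y₃, x₃⟫_ℂ) + c 5 * (⟪y₁, x₁⟫_ℂ * ⟪y₂, x₃⟫_ℂ * ⟪y₃, x₂⟫_ℂ)

/-- A function of six vectors is a contraction if it is a combination of complete contractions. -/
def IsContraction (f : H → H → H → H → H → H → ℂ) : Prop :=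
  ∃ c : Fin 6 → ℂ, ∀ x₁ x₂ x₃ y₁ y₂ y₃, f x₁ x₂ x₃ y₁ y₂ y₃ = contraction c x₁ x₂ x₃ y₁ y₂ y₃

/-- Three unit values `θ ≠ 1` suffice: after division by `θ - 1` a quadratic vanishes at three
points, and the weights below are Lagrange interpolation at `θ = 1`. -/
theorem eq_zero_of_unit_circle {a b c : ℂ}
    (h : ∀ θ : ℂ, ‖θ‖ = 1 → (θ - 1) * a + (θ - 1) ^ 2 * b + (θ - 1) ^ 3 * c = 0) : a = 0 := by
  have h1 := h Complex.I (by simp)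
  have h2 := h (-1) (by simp)
  have h3 := h (-Complex.I) (by simp)
  have hI := Complex.I_sq
  generalize Complex.I = i at h1 h2 h3 hI
  linear_combination ((i - 1) / 2) * h1 - 1 / 2 * h2 + ((-i - 1) / 2) * h3 +
    (3 * b - a - c * (i ^ 2 + 5)) * hI

/-- The difference of the two sides is the diagonal of a form linear in `p` and conjugate linear in
`q`. Homogeneity removes the norm condition, and complex polarization recovers the form. -/
theorem IsTrisesquilinear.rankOneInvariant_of_self {f : H → H → H → H → H → H → ℂ}
    (hf : IsTrisesquilinear f)
    (h : ∀ u x₁ x₂ x₃ y₁ y₂ y₃ : H, ‖u‖ = 1 →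
      ⟪u, x₁⟫_ℂ * f u x₂ x₃ y₁ y₂ y₃ + ⟪u, x₂⟫_ℂ * f x₁ u x₃ y₁ y₂ y₃ +
        ⟪u, x₃⟫_ℂ * f x₁ x₂ u y₁ y₂ y₃ =
      ⟪y₁, u⟫_ℂ * f x₁ x₂ x₃ u y₂ y₃ + ⟪y₂, u⟫_ℂ * f x₁ x₂ x₃ y₁ u y₃ +
        ⟪y₃, u⟫_ℂ * f x₁ x₂ x₃ y₁ y₂ u) : IsRankOneInvariant f := by
  intro p q x₁ x₂ x₃ y₁ y₂ y₃
  have h' : ∀ u : H,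
      ⟪u, x₁⟫_ℂ * f u x₂ x₃ y₁ y₂ y₃ + ⟪u, x₂⟫_ℂ * f x₁ u x₃ y₁ y₂ y₃ +
        ⟪u, x₃⟫_ℂ * f x₁ x₂ u y₁ y₂ y₃ =
      ⟪y₁, u⟫_ℂ * f x₁ x₂ x₃ u y₂ y₃ + ⟪y₂, u⟫_ℂ * f x₁ x₂ x₃ y₁ u y₃ +
        ⟪y₃, u⟫_ℂ * f x₁ x₂ x₃ y₁ y₂ u := by
    intro u
    obtain ⟨v, r, hv, rfl⟩ : ∃ (v : H) (r : ℂ), (r = 0 ∨ ‖v‖ = 1) ∧ u = r • v := by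
      by_cases hu : u = 0
      · exact ⟨0, 0, Or.inl rfl, by simp [hu]⟩
      · refine ⟨(‖u‖⁻¹ : ℂ) • u, ‖u‖, Or.inr (norm_smul_inv_norm hu), ?_⟩
        rw [smul_smul, mul_inv_cancel₀ (by simpa using hu), one_smul]
    simp only [hf.smul₁, hf.smul₂, hf.smul₃, hf.smul₄, hf.smul₅, hf.smul₆, inner_smul_left,
      inner_smul_right]
    rcases hv with rfl | hv
    · simp
    · linear_combination r * (starRingEnd ℂ) r * h v x₁ x₂ x₃ y₁ y₂ y₃ hv
  -- For such a form `E`, `p + q` yields `E(p,q) + E(q,p)` and `p + i q` yields `-i E(p,q) + i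
  -- E(q,p)`; half of the first plus `i/2` times the second is `E(p,q)`.
  have h1 := h' (p + q)
  have h2 := h' (p + Complex.I • q)
  have hp := h' p
  have hq := h' q
  simp only [hf.smul₁, hf.smul₂, hf.smul₃, hf.smul₄, hf.smul₅, hf.smul₆, hf.add₁, hf.add₂, hf.add₃,
    hf.add₄, hf.add₅, hf.add₆, inner_add_left, inner_add_right, inner_smul_left,
    inner_smul_right, Complex.conj_I] at h1 h2
  have hI := Complex.I_sq
  generalize Complex.I = i at h2 hI
  linear_combination (h1 - hp - hq) / 2 + i / 2 * (h2 - hp + i ^ 2 * hq) +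
    (⟪q, x₁⟫_ℂ * f p x₂ x₃ y₁ y₂ y₃ + ⟪q, x₂⟫_ℂ * f x₁ p x₃ y₁ y₂ y₃ +
      ⟪q, x₃⟫_ℂ * f x₁ x₂ p y₁ y₂ y₃ - ⟪p, x₁⟫_ℂ * f q x₂ x₃ y₁ y₂ y₃ -
      ⟪p, x₂⟫_ℂ * f x₁ q x₃ y₁ y₂ y₃ - ⟪p, x₃⟫_ℂ * f x₁ x₂ q y₁ y₂ y₃ +
      ⟪y₁, q⟫_ℂ * f x₁ x₂ x₃ p y₂ y₃ + ⟪y₂, q⟫_ℂ * f x₁ x₂ x₃ y₁ p y₃ +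
      ⟪y₃, q⟫_ℂ * f x₁ x₂ x₃ y₁ y₂ p - ⟪y₁, p⟫_ℂ * f x₁ x₂ x₃ q y₂ y₃ -
      ⟪y₂, p⟫_ℂ * f x₁ x₂ x₃ y₁ q y₃ - ⟪y₃, p⟫_ℂ * f x₁ x₂ x₃ y₁ y₂ q) / 2 * hI

variable [CompleteSpace H]

theorem star_reflection (u : H) (θ : ℂ) : star (1 + (θ - 1) • rankOne ℂ u u : H →L[ℂ] H) =
    1 + ((starRingEnd ℂ) θ - 1) • rankOne ℂ u u := by
  simp [star_eq_adjoint]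

theorem reflection_mem_unitary {u : H} (hu : ‖u‖ = 1) {θ : ℂ} (hθ : ‖θ‖ = 1) :
    1 + (θ - 1) • rankOne ℂ u u ∈ unitary (H →L[ℂ] H) := by
  have huu : ⟪u, u⟫_ℂ = 1 := by simp [inner_self_eq_norm_sq_to_K, hu]
  have hθ' : (starRingEnd ℂ) θ * θ = 1 := by
    rw [← Complex.normSq_eq_conj_mul_self, Complex.normSq_eq_norm_sq, hθ]; simp
  rw [Unitary.mem_iff, star_reflection]
  constructor <;>
  · ext x
    simp only [mul_apply_eq_comp, add_apply, smul_apply, one_apply_eq_self, rankOne_apply,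
      inner_add_right, inner_smul_right, huu]
    match_scalars
    · ring
    · linear_combination ⟪u, x⟫_ℂ * hθ'

/-- With `U` on the `xᵢ` and `U⋆` on the `yᵢ`, both sides are cubic in `θ - 1` alone: the
conjugation in `U⋆` cancels against conjugate linearity. -/
theorem IsTrisesquilinear.rankOneInvariant {f : H → H → H → H → H → H → ℂ}
    (hf : IsTrisesquilinear f)
    (h : ∀ U ∈ unitary (H →L[ℂ] H), ∀ x₁ x₂ x₃ y₁ y₂ y₃,
      f (U x₁) (U x₂) (U x₃) y₁ y₂ y₃ = f x₁ x₂ x₃ (star U y₁) (star U y₂) (star U y₃)) :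
    IsRankOneInvariant f := by
  refine hf.rankOneInvariant_of_self fun u x₁ x₂ x₃ y₁ y₂ y₃ hu => sub_eq_zero.1 ?_
  have key : ∀ θ : ℂ, ‖θ‖ = 1 → _ := fun θ hθ =>
    h _ (reflection_mem_unitary hu hθ) x₁ x₂ x₃ y₁ y₂ y₃
  simp only [star_reflection, add_apply, smul_apply, one_apply_eq_self, rankOne_apply,
    hf.smul₁, hf.smul₂, hf.smul₃, hf.smul₄, hf.smul₅, hf.smul₆, hf.add₁, hf.add₂, hf.add₃,
    hf.add₄, hf.add₅, hf.add₆, map_sub, map_one, Complex.conj_conj, inner_conj_symm] at key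
  -- `b` and `c` collect the terms in which the reflection acts on two and on three arguments.
  refine eq_zero_of_unit_circle (b :=
    ⟪u, x₁⟫_ℂ * ⟪u, x₂⟫_ℂ * f u u x₃ y₁ y₂ y₃ + ⟪u, x₁⟫_ℂ * ⟪u, x₃⟫_ℂ * f u x₂ u y₁ y₂ y₃ +
    ⟪u, x₂⟫_ℂ * ⟪u, x₃⟫_ℂ * f x₁ u u y₁ y₂ y₃ - (⟪y₁, u⟫_ℂ * ⟪y₂, u⟫_ℂ * f x₁ x₂ x₃ u u y₃ +
    ⟪y₁, u⟫_ℂ * ⟪y₃, u⟫_ℂ * f x₁ x₂ x₃ u y₂ u + ⟪y₂, u⟫_ℂ * ⟪y₃, u⟫_ℂ * f x₁ x₂ x₃ y₁ u u))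
    (c := ⟪u, x₁⟫_ℂ * ⟪u, x₂⟫_ℂ * ⟪u, x₃⟫_ℂ * f u u u y₁ y₂ y₃ -
      ⟪y₁, u⟫_ℂ * ⟪y₂, u⟫_ℂ * ⟪y₃, u⟫_ℂ * f x₁ x₂ x₃ u u u) fun θ hθ => ?_
  linear_combination key θ hθ

end Trisesquilinear

/-! ### Invariant forms are combinations of complete contractions -/

section Classification

variable {H : Type*} [NormedAddCommGroup H] [InnerProductSpace ℂ H]
variable {f : H → H → H → H → H → H → ℂ}

theorem IsRankOneInvariant.isContraction_of_orthonormal (h : IsRankOneInvariant f)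
    {e : Fin 3 → H} (he : Orthonormal ℂ e) : IsContraction f := by
  have hn : ∀ i, ⟪e i, e i⟫_ℂ = 1 := fun i => by simp [inner_self_eq_norm_sq_to_K, he.1 i]
  have h01 : ⟪e 0, e 1⟫_ℂ = 0 := he.2 (by decide)
  have h02 : ⟪e 0, e 2⟫_ℂ = 0 := he.2 (by decide)
  have h12 : ⟪e 1, e 2⟫_ℂ = 0 := he.2 (by decide)
  have h21 : ⟪e 2, e 1⟫_ℂ = 0 := he.2 (by decide)
  -- At `x = (e 0, e 1, e 2)` with the `yᵢ` a permutation of these, exactly one contraction is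
  -- nonzero, so its coefficient must be this value of `f`.
  refine ⟨![f (e 0) (e 1) (e 2) (e 2) (e 1) (e 0), f (e 0) (e 1) (e 2) (e 1) (e 0) (e 2),
    f (e 0) (e 1) (e 2) (e 2) (e 0) (e 1), f (e 0) (e 1) (e 2) (e 1) (e 2) (e 0),
    f (e 0) (e 1) (e 2) (e 0) (e 1) (e 2), f (e 0) (e 1) (e 2) (e 0) (e 2) (e 1)], ?_⟩
  have A : ∀ p y₁ y₂ y₃, f p (e 1) (e 2) y₁ y₂ y₃ = ⟪y₁, p⟫_ℂ * f (e 0) (e 1) (e 2) (e 0) y₂ y₃ +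
      ⟪y₂, p⟫_ℂ * f (e 0) (e 1) (e 2) y₁ (e 0) y₃ +
      ⟪y₃, p⟫_ℂ * f (e 0) (e 1) (e 2) y₁ y₂ (e 0) := fun p y₁ y₂ y₃ => by
    have := h p (e 0) (e 0) (e 1) (e 2) y₁ y₂ y₃
    simp only [hn, h01, h02] at this
    linear_combination this
  have B : ∀ p₁ p y₁ y₂ y₃, f p₁ p (e 2) y₁ y₂ y₃ = ⟪y₁, p⟫_ℂ * f p₁ (e 1) (e 2) (e 1) y₂ y₃ +
      ⟪y₂, p⟫_ℂ * f p₁ (e 1) (e 2) y₁ (e 1) y₃ +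
      ⟪y₃, p⟫_ℂ * f p₁ (e 1) (e 2) y₁ y₂ (e 1) - ⟪e 1, p₁⟫_ℂ * f p (e 1) (e 2) y₁ y₂ y₃ :=
    fun p₁ p y₁ y₂ y₃ => by
    have := h p (e 1) p₁ (e 1) (e 2) y₁ y₂ y₃
    simp only [hn, h12] at this
    linear_combination this
  have C : ∀ p₁ p₂ p y₁ y₂ y₃, f p₁ p₂ p y₁ y₂ y₃ = ⟪y₁, p⟫_ℂ * f p₁ p₂ (e 2) (e 2) y₂ y₃ +
      ⟪y₂, p⟫_ℂ * f p₁ p₂ (e 2) y₁ (e 2) y₃ +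
      ⟪y₃, p⟫_ℂ * f p₁ p₂ (e 2) y₁ y₂ (e 2) - ⟪e 2, p₁⟫_ℂ * f p p₂ (e 2) y₁ y₂ y₃
      - ⟪e 2, p₂⟫_ℂ * f p₁ p (e 2) y₁ y₂ y₃ :=
    fun p₁ p₂ p y₁ y₂ y₃ => by
    have := h p (e 2) p₁ p₂ (e 2) y₁ y₂ y₃
    simp only [hn] at this
    linear_combination this
  intro x₁ x₂ x₃ y₁ y₂ y₃
  -- The third, second and first slots are eliminated in turn. The rules are instantiated because
  -- their right-hand sides match their own left-hand sides. All terms containing `⟪e i, xⱼ⟫`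
  -- cancel.
  rw [C]
  simp only [B x₁ x₂, B x₁ x₃, B x₃ x₂]
  simp only [A x₁, A x₂, A x₃, contraction, Matrix.cons_val]
  ring

/-- The elimination runs with base point `(e 0, e 1, e 1)`. Taking `q = e 1` hits slots two and
three at once, so only the sum over their exchange is determined. -/
theorem IsRankOneInvariant.isContraction_add_swap (h : IsRankOneInvariant f)
    {e : Fin 2 → H} (he : Orthonormal ℂ e) :
    IsContraction fun x₁ x₂ x₃ y₁ y₂ y₃ => f x₁ x₂ x₃ y₁ y₂ y₃ + f x₁ x₃ x₂ y₁ y₂ y₃ := by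
  have hn : ∀ i, ⟪e i, e i⟫_ℂ = 1 := fun i => by simp [inner_self_eq_norm_sq_to_K, he.1 i]
  have h01 : ⟪e 0, e 1⟫_ℂ = 0 := he.2 (by decide)
  have A : ∀ p y₁ y₂ y₃, f p (e 1) (e 1) y₁ y₂ y₃ = ⟪y₁, p⟫_ℂ * f (e 0) (e 1) (e 1) (e 0) y₂ y₃ +
      ⟪y₂, p⟫_ℂ * f (e 0) (e 1) (e 1) y₁ (e 0) y₃ +
      ⟪y₃, p⟫_ℂ * f (e 0) (e 1) (e 1) y₁ y₂ (e 0) := fun p y₁ y₂ y₃ => by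
    have := h p (e 0) (e 0) (e 1) (e 1) y₁ y₂ y₃
    simp only [hn, h01] at this
    linear_combination this
  have B : ∀ p₁ p y₁ y₂ y₃, f p₁ p (e 1) y₁ y₂ y₃ + f p₁ (e 1) p y₁ y₂ y₃ =
      ⟪y₁, p⟫_ℂ * f p₁ (e 1) (e 1) (e 1) y₂ y₃ +
      ⟪y₂, p⟫_ℂ * f p₁ (e 1) (e 1) y₁ (e 1) y₃ +
      ⟪y₃, p⟫_ℂ * f p₁ (e 1) (e 1) y₁ y₂ (e 1) - ⟪e 1, p₁⟫_ℂ * f p (e 1) (e 1) y₁ y₂ y₃ :=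
    fun p₁ p y₁ y₂ y₃ => by
    have := h p (e 1) p₁ (e 1) (e 1) y₁ y₂ y₃
    simp only [hn] at this
    linear_combination this
  have C : ∀ p₁ p₂ p y₁ y₂ y₃, f p₁ p₂ p y₁ y₂ y₃ + f p₁ p p₂ y₁ y₂ y₃ =
      ⟪y₁, p⟫_ℂ * (f p₁ p₂ (e 1) (e 1) y₂ y₃ + f p₁ (e 1) p₂ (e 1) y₂ y₃) +
      ⟪y₂, p⟫_ℂ * (f p₁ p₂ (e 1) y₁ (e 1) y₃ + f p₁ (e 1) p₂ y₁ (e 1) y₃) +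
      ⟪y₃, p⟫_ℂ * (f p₁ p₂ (e 1) y₁ y₂ (e 1) + f p₁ (e 1) p₂ y₁ y₂ (e 1)) -
      ⟪e 1, p₁⟫_ℂ * (f p p₂ (e 1) y₁ y₂ y₃ + f p (e 1) p₂ y₁ y₂ y₃)
      - ⟪e 1, p₂⟫_ℂ * (f p₁ p (e 1) y₁ y₂ y₃ + f p₁ (e 1) p y₁ y₂ y₃) :=
    fun p₁ p₂ p y₁ y₂ y₃ => by
    have h1 := h p (e 1) p₁ p₂ (e 1) y₁ y₂ y₃
    have h2 := h p (e 1) p₁ (e 1) p₂ y₁ y₂ y₃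
    simp only [hn] at h1 h2
    linear_combination h1 + h2
  let α := f (e 0) (e 1) (e 1) (e 0) (e 1) (e 1)
  let β := f (e 0) (e 1) (e 1) (e 1) (e 0) (e 1)
  let γ := f (e 0) (e 1) (e 1) (e 1) (e 1) (e 0)
  -- By symmetry in `x₂, x₃`, a coefficient depends only on which `yᵢ` is paired with `x₁`: `α`,
  -- `β`, `γ` for `y₁`, `y₂`, `y₃`.
  refine ⟨![γ, β, β, γ, α, α], ?_⟩
  intro x₁ x₂ x₃ y₁ y₂ y₃
  dsimp only
  rw [C]
  simp only [B x₁ x₂, B x₁ x₃, B x₃ x₂]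
  simp only [A x₁, A x₂, A x₃, contraction, Matrix.cons_val, α, β, γ]
  ring

/-- An alternating trilinear form vanishes on a space spanned by two vectors. -/
theorem IsTrisesquilinear.alternating_eq_zero (hf : IsTrisesquilinear f) {e₁ e₂ : H}
    (he : ∀ x : H, ∃ a b : ℂ, x = a • e₁ + b • e₂) (x₁ x₂ x₃ y₁ y₂ y₃ : H) :
    f x₁ x₂ x₃ y₁ y₂ y₃ - f x₁ x₃ x₂ y₁ y₂ y₃ - f x₂ x₁ x₃ y₁ y₂ y₃ - f x₃ x₂ x₁ y₁ y₂ y₃ +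
      f x₂ x₃ x₁ y₁ y₂ y₃ + f x₃ x₁ x₂ y₁ y₂ y₃ = 0 := by
  obtain ⟨a₁, b₁, rfl⟩ := he x₁
  obtain ⟨a₂, b₂, rfl⟩ := he x₂
  obtain ⟨a₃, b₃, rfl⟩ := he x₃
  simp only [hf.add₁, hf.add₂, hf.add₃, hf.smul₁, hf.smul₂, hf.smul₃]
  ring

theorem isTrisesquilinear_contraction (c : Fin 6 → ℂ) :
    IsTrisesquilinear (contraction (H := H) c) := by
  constructor <;> intros <;>
    simp only [contraction, inner_add_left, inner_add_right, inner_smul_left, inner_smul_right] <;>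
    ring

/-- In the group algebra of S₃, six times the identity is the antisymmetrizer plus a combination of
translates of the elements `1 + τ`, `τ` a transposition. The antisymmetrizer kills `f`, and each `1
+ τ` sends it to a contraction. -/
theorem IsRankOneInvariant.isContraction_of_span_pair (h : IsRankOneInvariant f)
    (hf : IsTrisesquilinear f) {e : Fin 2 → H} (he : Orthonormal ℂ e)
    (hs : ∀ x : H, ∃ a b : ℂ, x = a • e 0 + b • e 1) : IsContraction f := by
  have h' : IsRankOneInvariant fun x₁ x₂ x₃ => f x₂ x₁ x₃ := fun p q x₁ x₂ x₃ y₁ y₂ y₃ => by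
    linear_combination h p q x₂ x₁ x₃ y₁ y₂ y₃
  have h'' : IsRankOneInvariant fun x₁ x₂ x₃ => f x₃ x₂ x₁ := fun p q x₁ x₂ x₃ y₁ y₂ y₃ => by
    linear_combination h p q x₃ x₂ x₁ y₁ y₂ y₃
  obtain ⟨c, hc⟩ := h.isContraction_add_swap he
  obtain ⟨c', hc'⟩ := h'.isContraction_add_swap he
  obtain ⟨c'', hc''⟩ := h''.isContraction_add_swap he
  -- The lists reindex the coefficients of `c'` and `c''` according to the permutations of the `xᵢ`
  -- in `h2` to `h5`.
  refine ⟨fun i => (3 * c i + ![c' 2, c' 4, c' 0, c' 5, c' 1, c' 3] i -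
    ![c' 4, c' 3, c' 5, c' 1, c' 0, c' 2] i - ![c'' 2, c'' 4, c'' 0, c'' 5, c'' 1, c'' 3] i +
    ![c'' 4, c'' 3, c'' 5, c'' 1, c'' 0, c'' 2] i) / 6, fun x₁ x₂ x₃ y₁ y₂ y₃ => ?_⟩
  have h0 := hf.alternating_eq_zero hs x₁ x₂ x₃ y₁ y₂ y₃
  have h1 := hc x₁ x₂ x₃ y₁ y₂ y₃
  have h2 := hc' x₂ x₁ x₃ y₁ y₂ y₃
  have h3 := hc' x₃ x₂ x₁ y₁ y₂ y₃
  have h4 := hc'' x₂ x₁ x₃ y₁ y₂ y₃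
  have h5 := hc'' x₃ x₂ x₁ y₁ y₂ y₃
  simp only [contraction, Matrix.cons_val] at h1 h2 h3 h4 h5 ⊢
  linear_combination (h0 + 3 * h1 + h2 - h3 - h4 + h5) / 6

end Classification

/-! ### Rank-one operators in the trace class -/

section RankOneTraceClass

variable {H : Type*} [NormedAddCommGroup H] [InnerProductSpace ℂ H]

theorem enorm_inner_comm (x y : H) : ‖⟪x, y⟫_ℂ‖ₑ = ‖⟪y, x⟫_ℂ‖ₑ := by
  rw [← inner_conj_symm, ← ofReal_norm, RCLike.norm_conj, ofReal_norm]

theorem tsum_enorm_inner_le {ι : Type*} (x y : ι → H) :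
    (∑' i, ‖⟪x i, y i⟫_ℂ‖ₑ) ≤
      (∑' i, ‖x i‖ₑ ^ 2) ^ (1 / 2 : ℝ) * (∑' i, ‖y i‖ₑ ^ 2) ^ (1 / 2 : ℝ) := by
  let _ : MeasurableSpace ι := ⊤
  have h := ENNReal.lintegral_mul_le_Lp_mul_Lq MeasureTheory.Measure.count
    (p := 2) (q := 2) (by constructor <;> norm_num) (f := fun i => ‖x i‖ₑ) (g := fun i => ‖y i‖ₑ)
    (measurable_from_top.aemeasurable) (measurable_from_top.aemeasurable)
  simp only [MeasureTheory.lintegral_count, Pi.mul_apply, ENNReal.rpow_ofNat] at h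
  refine le_trans (ENNReal.tsum_le_tsum fun i => ?_) h
  rw [← ofReal_norm, ← ofReal_norm, ← ofReal_norm, ← ENNReal.ofReal_mul (norm_nonneg _)]
  exact ENNReal.ofReal_le_ofReal (norm_inner_le_norm _ _)

variable [CompleteSpace H]

theorem isTraceClass_rankOne (x y : H) : IsTraceClass (rankOne ℂ x y) := by
  obtain ⟨W, -, h⟩ := traceNorm_le_of_polar (rankOne ℂ x y)
  refine ne_top_of_le_ne_top ?_ h
  refine ne_top_of_le_ne_top (b := ‖y‖ₑ ^ 2 + ‖adjoint W x‖ₑ ^ 2) (by simp) ?_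
  rw [parseval (stdBasis H) y, parseval (stdBasis H) (adjoint W x), ← ENNReal.tsum_add]
  refine ENNReal.tsum_le_tsum fun i => ?_
  rw [rankOne_apply, inner_smul_right, enorm_mul, enorm_inner_comm y, ← adjoint_inner_right]
  set a := ‖⟪stdBasis H i, y⟫_ℂ‖ₑ
  set b := ‖⟪stdBasis H i, adjoint W x⟫_ℂ‖ₑ
  rcases le_total a b with h | h
  · exact le_add_left ((mul_le_mul_left h _).trans_eq (sq _).symm)
  · exact le_add_right ((mul_le_mul_right h _).trans_eq (sq _).symm)

/-- The operator `|x⟩⟨y|` as a trace class operator. -/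
def TraceClass.rankOne (x y : H) : TraceClass H :=
  ⟨InnerProductSpace.rankOne ℂ x y, isTraceClass_rankOne x y⟩

theorem TraceClass.toCLM_rankOne (x y : H) :
    (TraceClass.rankOne x y).toCLM = InnerProductSpace.rankOne ℂ x y := rfl

theorem TraceClass.conj_rankOne (U : unitary (H →L[ℂ] H)) (x y : H) :
    TraceClass.conj U (TraceClass.rankOne x y) =
      TraceClass.rankOne ((U : H →L[ℂ] H) x) ((U : H →L[ℂ] H) y) := by
  refine TraceClass.toCLM_injective ?_
  ext z
  simp [TraceClass.toCLM_conj, TraceClass.toCLM_rankOne, star_eq_adjoint, adjoint_inner_right]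

theorem TraceClass.trace_rankOne (x y : H) : (TraceClass.rankOne x y).trace = ⟪y, x⟫_ℂ := by
  refine (TraceClass.hasSum_trace (stdBasis H) _).unique ?_
  simpa [TraceClass.toCLM_rankOne] using (stdBasis H).hasSum_inner_mul_inner y x

/-- The expansion `X = ∑ᵢ |X bᵢ⟩⟨bᵢ|` converges in the trace norm. -/
theorem TraceClass.hasSum_rankOne (X : TraceClass H) :
    HasSum (fun i => TraceClass.rankOne (X.toCLM (stdBasis H i)) (stdBasis H i)) X := by
  obtain ⟨B, C, hX, hB, hC⟩ := exists_factor X.toCLM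
  have hB' := ne_top_of_le_ne_top X.isTraceClass hB
  have hC' := ne_top_of_le_ne_top X.isTraceClass hC
  have hon := (stdBasis H).orthonormal
  classical
  have hD : ∀ (s : Finset (basisSet H)) j,
      toCLM (X - ∑ i ∈ s, TraceClass.rankOne (X.toCLM (stdBasis H i)) (stdBasis H i))
        (stdBasis H j) = if j ∈ s then 0 else adjoint B (C (stdBasis H j)) := fun s j => by
    rw [map_sub, map_sum, sub_apply, sum_apply]
    simp only [toCLM_rankOne, rankOne_apply, orthonormal_iff_ite.1 hon, ite_smul, one_smul,
      zero_smul, Finset.sum_ite_eq']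
    split_ifs
    · simp
    · rw [sub_zero, hX]; rfl
  -- Write `X = B⋆C` with Hilbert-Schmidt factors. The remainder kills `bⱼ` for `j ∈ s` and agrees
  -- with `X` on the others, so polar decomposition and Cauchy-Schwarz bound its trace norm by a
  -- tail of the Hilbert-Schmidt series of `C`.
  have hle : ∀ s : Finset (basisSet H),
      traceNorm (toCLM (X - ∑ i ∈ s, TraceClass.rankOne (X.toCLM (stdBasis H i)) (stdBasis H i))) ≤
        hs (stdBasis H) B ^ (1 / 2 : ℝ) *
          (∑' j : {j // j ∉ s}, ‖C (stdBasis H j)‖ₑ ^ 2) ^ (1 / 2 : ℝ) := fun s => by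
    obtain ⟨W, hW, h⟩ := traceNorm_le_of_polar
      (toCLM (X - ∑ i ∈ s, TraceClass.rankOne (X.toCLM (stdBasis H i)) (stdBasis H i)))
    refine h.trans ?_
    have e1 : (∑' j : {j // j ∉ s}, ‖C (stdBasis H j)‖ₑ ^ 2) =
        ∑' j, ‖if j ∈ s then 0 else C (stdBasis H j)‖ₑ ^ 2 := by
      rw [← tsum_subtype_eq_of_support_subset (s := {j | j ∉ s})]
      · refine tsum_congr fun j => ?_
        rw [if_neg j.2]
      · intro j hj hjs
        simp [hjs] at hj
    rw [e1]
    refine le_trans (le_of_eq ?_) ((tsum_enorm_inner_le (fun j => B (W (stdBasis H j))) _).trans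
      (mul_le_mul_left (ENNReal.rpow_le_rpow ((hs_comp_right (stdBasis H) hW B))
        (by norm_num)) _))
    refine tsum_congr fun j => ?_
    rw [hD]
    split_ifs
    · simp
    · rw [adjoint_inner_right]
  rw [HasSum]
  refine tendsto_iff_norm_sub_tendsto_zero.2 ?_
  have hlim : Tendsto (fun s : Finset (basisSet H) => hs (stdBasis H) B ^ (1 / 2 : ℝ) *
      (∑' j : {j // j ∉ s}, ‖C (stdBasis H j)‖ₑ ^ 2) ^ (1 / 2 : ℝ)) atTop (𝓝 0) := by
    have h1 := ENNReal.tendsto_tsum_compl_atTop_zero hC'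
    have h2 := (ENNReal.continuous_rpow_const (y := (1 / 2 : ℝ))).continuousAt.tendsto.comp h1
    rw [ENNReal.zero_rpow_of_pos (by norm_num)] at h2
    have h3 := ENNReal.Tendsto.const_mul h2
      (Or.inr (ENNReal.rpow_ne_top_of_nonneg (y := (1 / 2 : ℝ)) (by norm_num) hB'))
    rw [mul_zero] at h3
    exact h3
  have h0 := tendsto_of_tendsto_of_tendsto_of_le_of_le tendsto_const_nhds hlim
    (fun _ => zero_le) hle
  have h1 := (ENNReal.tendsto_toReal ENNReal.zero_ne_top).comp h0
  refine h1.congr fun s => ?_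
  rw [norm_sub_rev, norm_def]
  rfl

/-- Computed in the basis `U bᵢ`, the trace of `U X U⋆` has the same terms as the trace of `X` in
the basis `bᵢ`. -/
theorem TraceClass.trace_conj (U : unitary (H →L[ℂ] H)) (X : TraceClass H) :
    (TraceClass.conj U X).trace = X.trace := by
  let b : HilbertBasis (basisSet H) ℂ H :=
    HilbertBasis.ofRepr ((Unitary.linearIsometryEquiv U).symm.trans (stdBasis H).repr)
  have hb : ∀ i, b i = (U : H →L[ℂ] H) (stdBasis H i) := fun i => by
    classical
    rw [← HilbertBasis.repr_symm_single, ← HilbertBasis.repr_symm_single]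
    rfl
  refine (TraceClass.hasSum_trace b _).unique ?_
  convert TraceClass.hasSum_trace (stdBasis H) X using 2 with i
  have hU : ∀ x, star (U : H →L[ℂ] H) ((U : H →L[ℂ] H) x) = x := fun x =>
    congrArg (fun A : H →L[ℂ] H => A x) (Unitary.star_mul_self_of_mem U.2)
  rw [hb, TraceClass.toCLM_conj, mul_apply_eq_comp, mul_apply_eq_comp, ← adjoint_inner_left,
    ← star_eq_adjoint, hU]

end RankOneTraceClass

/-! ### Operators on the tensor square and their matrix elements -/

section TensorSquare

variable {H : Type*} [NormedAddCommGroup H] [InnerProductSpace ℂ H]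

/-- The elementary tensor `x ⊗ y` in the Hilbert space tensor square. -/
def tmul (x y : H) : HilbertTensor H := ((x ⊗ₜ[ℂ] y : H ⊗[ℂ] H) : HilbertTensor H)

theorem inner_tmul_tmul (a b x y : H) : ⟪tmul a b, tmul x y⟫_ℂ = ⟪a, x⟫_ℂ * ⟪b, y⟫_ℂ := by
  rw [tmul, tmul, UniformSpace.Completion.inner_coe, TensorProduct.inner_tmul]

theorem tensorOp_apply_tmul (A B : H →L[ℂ] H) (x y : H) :
    tensorOp A B (tmul x y) = tmul (A x) (B y) := tensorOp_tmul A B x y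

theorem swap_apply_tmul (x y : H) : swap H (tmul x y) = tmul y x := swap_tmul x y

theorem tmul_add (x y z : H) : tmul x (y + z) = tmul x y + tmul x z := by
  simp only [tmul, TensorProduct.tmul_add, UniformSpace.Completion.coe_add]

theorem add_tmul (x y z : H) : tmul (x + y) z = tmul x z + tmul y z := by
  simp only [tmul, TensorProduct.add_tmul, UniformSpace.Completion.coe_add]

theorem tmul_smul (c : ℂ) (x y : H) : tmul x (c • y) = c • tmul x y := by
  simp only [tmul, TensorProduct.tmul_smul, UniformSpace.Completion.coe_smul]

theorem smul_tmul (c : ℂ) (x y : H) : tmul (c • x) y = c • tmul x y := by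
  simp only [tmul, ← TensorProduct.smul_tmul', UniformSpace.Completion.coe_smul]

theorem ext_tmul {A B : HilbertTensor H →L[ℂ] HilbertTensor H}
    (h : ∀ x y, A (tmul x y) = B (tmul x y)) : A = B := by
  ext v
  refine UniformSpace.Completion.induction_on v (isClosed_eq A.continuous B.continuous) fun w => ?_
  induction w with
  | zero => rw [UniformSpace.Completion.coe_zero, map_zero, map_zero]
  | add w z hw hz => rw [UniformSpace.Completion.coe_add, map_add, map_add, hw, hz]
  | tmul x y => exact h x y

theorem eq_of_inner_tmul {v w : HilbertTensor H} (h : ∀ x y, ⟪tmul x y, v⟫_ℂ = ⟪tmul x y, w⟫_ℂ) :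
    v = w := by
  refine ext_inner_left ℂ fun z => ?_
  refine UniformSpace.Completion.induction_on z (isClosed_eq (by fun_prop) (by fun_prop))
    fun t => ?_
  induction t with
  | zero => rw [UniformSpace.Completion.coe_zero, inner_zero_left, inner_zero_left]
  | add a b ha hb => rw [UniformSpace.Completion.coe_add, inner_add_left, inner_add_left, ha, hb]
  | tmul x y => exact h x y

theorem tensorOp_mul_tensorOp (A B C D : H →L[ℂ] H) :
    tensorOp A B * tensorOp C D = tensorOp (A * C) (B * D) :=
  ext_tmul fun x y => by simp [tensorOp_apply_tmul]

theorem tensorOp_mul_swap (A B : H →L[ℂ] H) : tensorOp A B * swap H = swap H * tensorOp B A :=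
  ext_tmul fun x y => by simp [tensorOp_apply_tmul, swap_apply_tmul]

theorem tensorOp_one_one : tensorOp (1 : H →L[ℂ] H) 1 = 1 :=
  ext_tmul fun x y => by simp [tensorOp_apply_tmul]

variable [CompleteSpace H]

theorem adjoint_tensorOp (A B : H →L[ℂ] H) :
    adjoint (tensorOp A B) = tensorOp (adjoint A) (adjoint B) :=
  ext_tmul fun x y => eq_of_inner_tmul fun z w => by
    rw [adjoint_inner_right]
    simp [tensorOp_apply_tmul, inner_tmul_tmul, adjoint_inner_right]

theorem tensorOp_conj (U : unitary (H →L[ℂ] H)) (A B : H →L[ℂ] H) :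
    tensorOp (U : H →L[ℂ] H) (U : H →L[ℂ] H) * tensorOp A B *
        tensorOp (star (U : H →L[ℂ] H)) (star (U : H →L[ℂ] H)) =
      tensorOp ((U : H →L[ℂ] H) * A * star (U : H →L[ℂ] H)) ((U : H →L[ℂ] H) * B * star (U : H →L[ℂ] H)) := by
  rw [tensorOp_mul_tensorOp, tensorOp_mul_tensorOp]

theorem swap_mul_tensorOp_conj (U : unitary (H →L[ℂ] H)) (A B : H →L[ℂ] H) :
    tensorOp (U : H →L[ℂ] H) (U : H →L[ℂ] H) * (swap H * tensorOp A B) *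
        tensorOp (star (U : H →L[ℂ] H)) (star (U : H →L[ℂ] H)) =
      swap H * tensorOp ((U : H →L[ℂ] H) * A * star (U : H →L[ℂ] H)) ((U : H →L[ℂ] H) * B * star (U : H →L[ℂ] H)) := by
  rw [← mul_assoc, tensorOp_mul_swap, mul_assoc, mul_assoc, ← mul_assoc (tensorOp _ _),
    tensorOp_conj]

theorem canonicalForm_conj (c : Fin 6 → ℂ) (U : unitary (H →L[ℂ] H)) (X : TraceClass H) :
    canonicalForm c (TraceClass.conj U X) =
      tensorOp (U : H →L[ℂ] H) (U : H →L[ℂ] H) * canonicalForm c X *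
        tensorOp (star (U : H →L[ℂ] H)) (star (U : H →L[ℂ] H)) := by
  have hU : (U : H →L[ℂ] H) * star (U : H →L[ℂ] H) = 1 := Unitary.mul_star_self_of_mem U.2
  have hS := swap_mul_tensorOp_conj U 1 1
  rw [tensorOp_one_one, mul_one, mul_one, hU, tensorOp_one_one, mul_one] at hS
  simp only [canonicalForm, mul_add, add_mul, mul_smul_comm, smul_mul_assoc, tensorOp_conj,
    swap_mul_tensorOp_conj, hS, mul_one, hU, TraceClass.trace_conj, TraceClass.toCLM_conj]

/-- The matrix elements `⟨y₂ ⊗ y₃, Φ(|x₁⟩⟨y₁|) (x₂ ⊗ x₃)⟩`. -/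
def matrixElement (Φ : TraceClass H → (HilbertTensor H →L[ℂ] HilbertTensor H))
    (x₁ x₂ x₃ y₁ y₂ y₃ : H) : ℂ :=
  ⟪tmul y₂ y₃, Φ (TraceClass.rankOne x₁ y₁) (tmul x₂ x₃)⟫_ℂ

theorem inner_canonicalForm (c : Fin 6 → ℂ) (X : TraceClass H) (x₂ x₃ y₂ y₃ : H) :
    ⟪tmul y₂ y₃, canonicalForm c X (tmul x₂ x₃)⟫_ℂ =
      c 0 * (⟪y₂, x₂⟫_ℂ * ⟪y₃, X.toCLM x₃⟫_ℂ) + c 1 * (⟪y₃, x₃⟫_ℂ * ⟪y₂, X.toCLM x₂⟫_ℂ) +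
      c 2 * (⟪y₂, X.toCLM x₃⟫_ℂ * ⟪y₃, x₂⟫_ℂ) + c 3 * (⟪y₂, x₃⟫_ℂ * ⟪y₃, X.toCLM x₂⟫_ℂ) +
      c 4 * (X.trace * ⟪y₂, x₂⟫_ℂ * ⟪y₃, x₃⟫_ℂ) + c 5 * (X.trace * ⟪y₂, x₃⟫_ℂ * ⟪y₃, x₂⟫_ℂ) := by
  simp only [canonicalForm, add_apply, smul_apply, mul_apply_eq_comp, tensorOp_apply_tmul,
    swap_apply_tmul, inner_add_right, inner_smul_right, inner_tmul_tmul, one_apply_eq_self]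
  ring

theorem matrixElement_canonicalForm (c : Fin 6 → ℂ) :
    matrixElement (canonicalForm (H := H) c) = contraction c := by
  ext x₁ x₂ x₃ y₁ y₂ y₃
  simp only [matrixElement, inner_canonicalForm, TraceClass.trace_rankOne,
    TraceClass.toCLM_rankOne, rankOne_apply, inner_smul_right, contraction]
  ring

variable (Φ : TraceClass H →L[ℂ] (HilbertTensor H →L[ℂ] HilbertTensor H))

theorem isTrisesquilinear_matrixElement : IsTrisesquilinear (matrixElement Φ) := by
  have h1 : ∀ x x' y : H, TraceClass.rankOne (x + x') y =
      TraceClass.rankOne x y + TraceClass.rankOne x' y := fun x x' y =>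
    TraceClass.toCLM_injective (by simp [TraceClass.toCLM_rankOne])
  have h2 : ∀ x y y' : H, TraceClass.rankOne x (y + y') =
      TraceClass.rankOne x y + TraceClass.rankOne x y' := fun x y y' =>
    TraceClass.toCLM_injective (by simp [TraceClass.toCLM_rankOne])
  have h3 : ∀ (c : ℂ) (x y : H), TraceClass.rankOne (c • x) y =
      c • TraceClass.rankOne x y := fun c x y =>
    TraceClass.toCLM_injective (by simp [TraceClass.toCLM_rankOne])
  have h4 : ∀ (c : ℂ) (x y : H), TraceClass.rankOne x (c • y) =
      (starRingEnd ℂ) c • TraceClass.rankOne x y := fun c x y =>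
    TraceClass.toCLM_injective (by simp [TraceClass.toCLM_rankOne])
  constructor <;> intros <;>
    simp only [matrixElement, h1, h2, h3, h4, map_add, map_smul, add_apply, smul_apply, tmul_add,
      add_tmul, tmul_smul, smul_tmul, inner_add_left, inner_add_right, inner_smul_left,
      inner_smul_right]

variable {Φ}

theorem IsCovariant.matrixElement_map (h : IsCovariant Φ) {U : H →L[ℂ] H}
    (hU : U ∈ unitary (H →L[ℂ] H)) (x₁ x₂ x₃ y₁ y₂ y₃ : H) :
    matrixElement Φ (U x₁) (U x₂) (U x₃) y₁ y₂ y₃ =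
      matrixElement Φ x₁ x₂ x₃ (star U y₁) (star U y₂) (star U y₃) := by
  have h1 : ∀ x, star U (U x) = x := fun x =>
    congrArg (fun A : H →L[ℂ] H => A x) (Unitary.star_mul_self_of_mem hU)
  have h2 : ∀ x, U (star U x) = x := fun x =>
    congrArg (fun A : H →L[ℂ] H => A x) (Unitary.mul_star_self_of_mem hU)
  -- Conjugation puts `U` on both vectors, so starting from `U⋆ y₁` leaves `y₁` afterwards.
  have h3 := h ⟨U, hU⟩ (TraceClass.rankOne x₁ (star U y₁))
  rw [TraceClass.conj_rankOne] at h3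
  simp only [h2] at h3
  rw [matrixElement, h3, mul_apply_eq_comp, mul_apply_eq_comp, ← adjoint_inner_left,
    adjoint_tensorOp, tensorOp_apply_tmul, tensorOp_apply_tmul, h1, h1]
  rfl

theorem IsCovariant.isRankOneInvariant (h : IsCovariant Φ) :
    IsRankOneInvariant (matrixElement Φ) :=
  (isTrisesquilinear_matrixElement Φ).rankOneInvariant fun _ hU => h.matrixElement_map hU

/-- Continuity of `Φ` enters here: it is applied termwise to `X = ∑ |X bᵢ⟩⟨bᵢ|`. On the other side
Parseval sums the first four contractions, and the trace series sums the last two. -/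
theorem eq_canonicalForm_of_matrixElement {c : Fin 6 → ℂ}
    (h : ∀ x₁ x₂ x₃ y₁ y₂ y₃, matrixElement Φ x₁ x₂ x₃ y₁ y₂ y₃ = contraction c x₁ x₂ x₃ y₁ y₂ y₃)
    (X : TraceClass H) : Φ X = canonicalForm c X := by
  refine ext_tmul fun x₂ x₃ => eq_of_inner_tmul fun y₂ y₃ => ?_
  have h1 := ((((ContinuousLinearMap.apply ℂ (HilbertTensor H) (tmul x₂ x₃)).comp Φ).hasSum
    X.hasSum_rankOne)).mapL (innerSL ℂ (tmul y₂ y₃))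
  refine h1.unique ?_
  have e : ∀ i, innerSL ℂ (tmul y₂ y₃) (((ContinuousLinearMap.apply ℂ (HilbertTensor H)
      (tmul x₂ x₃)).comp Φ) (TraceClass.rankOne (X.toCLM (stdBasis H i)) (stdBasis H i))) =
      contraction c (X.toCLM (stdBasis H i)) x₂ x₃ (stdBasis H i) y₂ y₃ := fun i => h _ _ _ _ _ _
  rw [inner_canonicalForm]
  have hs : ∀ x y : H, HasSum (fun i => ⟪y, X.toCLM (stdBasis H i)⟫_ℂ * ⟪stdBasis H i, x⟫_ℂ)
      ⟪y, X.toCLM x⟫_ℂ := fun x y => by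
    simpa only [adjoint_inner_left] using
      (stdBasis H).hasSum_inner_mul_inner (adjoint X.toCLM y) x
  have ht := TraceClass.hasSum_trace (stdBasis H) X
  have hsum := (((((((hs x₃ y₃).mul_left ⟪y₂, x₂⟫_ℂ).mul_left (c 0)).add
    (((hs x₂ y₂).mul_left ⟪y₃, x₃⟫_ℂ).mul_left (c 1))).add
    (((hs x₃ y₂).mul_right ⟪y₃, x₂⟫_ℂ).mul_left (c 2))).add
    (((hs x₂ y₃).mul_left ⟪y₂, x₃⟫_ℂ).mul_left (c 3))).add
    (((ht.mul_right ⟪y₂, x₂⟫_ℂ).mul_right ⟪y₃, x₃⟫_ℂ).mul_left (c 4))).add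
    (((ht.mul_right ⟪y₂, x₃⟫_ℂ).mul_right ⟪y₃, x₂⟫_ℂ).mul_left (c 5))
  refine (congrArg (HasSum · _) (funext fun i => ?_)).mp hsum
  refine Eq.trans ?_ (e i).symm
  rw [contraction]
  ring

end TensorSquare

/-! ### Independence and dependence of the six contractions -/

section Dimension

variable {H : Type*} [NormedAddCommGroup H] [InnerProductSpace ℂ H]

theorem exists_orthonormal_of_le_rank {n : ℕ} (h : (n : Cardinal) ≤ Module.rank ℂ H) :
    ∃ e : Fin n → H, Orthonormal ℂ e := by
  obtain ⟨s, hs, hli⟩ := le_rank_iff_exists_linearIndependent_finset.1 h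
  exact ⟨_, gramSchmidtNormed_orthonormal
    (hli.comp _ (s.equivFinOfCardEq hs).symm.injective)⟩

theorem contraction_injective_of_orthonormal {e : Fin 3 → H} (he : Orthonormal ℂ e) :
    Function.Injective (contraction (H := H)) := by
  have hn : ∀ i, ⟪e i, e i⟫_ℂ = 1 := fun i => by simp [inner_self_eq_norm_sq_to_K, he.1 i]
  have h01 : ⟪e 0, e 1⟫_ℂ = 0 := he.2 (by decide)
  have h02 : ⟪e 0, e 2⟫_ℂ = 0 := he.2 (by decide)
  have h12 : ⟪e 1, e 2⟫_ℂ = 0 := he.2 (by decide)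
  have h21 : ⟪e 2, e 1⟫_ℂ = 0 := he.2 (by decide)
  have h10 : ⟪e 1, e 0⟫_ℂ = 0 := he.2 (by decide)
  have h20 : ⟪e 2, e 0⟫_ℂ = 0 := he.2 (by decide)
  intro c d hcd
  have h : ∀ y₁ y₂ y₃, contraction c (e 0) (e 1) (e 2) y₁ y₂ y₃ =
      contraction d (e 0) (e 1) (e 2) y₁ y₂ y₃ := fun _ _ _ => by rw [hcd]
  have k0 := h (e 2) (e 1) (e 0)
  have k1 := h (e 1) (e 0) (e 2)
  have k2 := h (e 2) (e 0) (e 1)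
  have k3 := h (e 1) (e 2) (e 0)
  have k4 := h (e 0) (e 1) (e 2)
  have k5 := h (e 0) (e 2) (e 1)
  simp only [contraction, hn, h01, h02, h12, h21, h10, h20, mul_zero, mul_one, add_zero, zero_add] at k0 k1 k2 k3 k4 k5
  ext i
  fin_cases i <;> assumption

/-- The coefficients are the signs of the six pairings, so this is the determinant of `⟪yᵢ, xⱼ⟫`,
obtained by antisymmetrizing the single product `⟪y₁, x₁⟫ ⟪y₂, x₂⟫ ⟪y₃, x₃⟫`. -/
theorem contraction_sign_eq_zero {e₁ e₂ : H} (he : ∀ x : H, ∃ a b : ℂ, x = a • e₁ + b • e₂)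
    (x₁ x₂ x₃ y₁ y₂ y₃ : H) : contraction ![-1, -1, 1, 1, 1, -1] x₁ x₂ x₃ y₁ y₂ y₃ = 0 := by
  rw [← (isTrisesquilinear_contraction ![0, 0, 0, 0, 1, 0]).alternating_eq_zero he
    x₁ x₂ x₃ y₁ y₂ y₃]
  simp only [contraction, Matrix.cons_val]
  ring

theorem exists_eq_add_of_rank_eq_two (h : Module.rank ℂ H = 2) {e : Fin 2 → H}
    (he : Orthonormal ℂ e) (x : H) : ∃ a b : ℂ, x = a • e 0 + b • e 1 := by
  have hfin : Module.finrank ℂ H = 2 := Module.finrank_eq_of_rank_eq h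
  have hs := he.linearIndependent.span_eq_top_of_card_eq_finrank (by simp [hfin])
  have hx : x ∈ Submodule.span ℂ (Set.range e) := hs ▸ Submodule.mem_top
  obtain ⟨c, rfl⟩ := (Submodule.mem_span_range_iff_exists_fun ℂ).1 hx
  exact ⟨c 0, c 1, by simp⟩

end Dimension

/-! ### Covariant maps and the canonical form -/

section CovariantForm

variable {H : Type*} [NormedAddCommGroup H] [InnerProductSpace ℂ H] [CompleteSpace H]
variable {Φ : TraceClass H →L[ℂ] (HilbertTensor H →L[ℂ] HilbertTensor H)}

theorem matrixElement_of_eq_canonicalForm {c : Fin 6 → ℂ} (h : ∀ X, Φ X = canonicalForm c X) :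
    matrixElement Φ = contraction c := by
  rw [← matrixElement_canonicalForm]
  exact congrArg matrixElement (funext h)

theorem isCovariant_of_eq_canonicalForm {c : Fin 6 → ℂ} (h : ∀ X, Φ X = canonicalForm c X) :
    IsCovariant Φ := fun U X => by
  rw [h, h, canonicalForm_conj]

theorem IsCovariant.exists_eq_canonicalForm (hdim : 2 ≤ Module.rank ℂ H) (h : IsCovariant Φ) :
    ∃ c : Fin 6 → ℂ, ∀ X, Φ X = canonicalForm c X := by
  have hc : IsContraction (matrixElement Φ) := by
    by_cases h3 : 3 ≤ Module.rank ℂ H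
    · obtain ⟨e, he⟩ := exists_orthonormal_of_le_rank (n := 3) (by exact_mod_cast h3)
      exact h.isRankOneInvariant.isContraction_of_orthonormal he
    · have h2 : Module.rank ℂ H = 2 := by
        refine le_antisymm ?_ hdim
        rw [not_le] at h3
        obtain ⟨n, hn⟩ := Cardinal.lt_aleph0.1 (h3.trans Cardinal.ofNat_lt_aleph0)
        rw [hn] at h3 ⊢
        have hn3 : n < 3 := by exact_mod_cast h3
        exact_mod_cast Nat.lt_succ_iff.1 hn3
      obtain ⟨e, he⟩ := exists_orthonormal_of_le_rank (n := 2) (by exact_mod_cast hdim)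
      exact h.isRankOneInvariant.isContraction_of_span_pair (isTrisesquilinear_matrixElement Φ) he
        (exists_eq_add_of_rank_eq_two h2 he)
  obtain ⟨c, hc⟩ := hc
  exact ⟨c, eq_canonicalForm_of_matrixElement hc⟩

end CovariantForm

end UnitaryCovariance

end

theorem theorem1 {H : Type*} [NormedAddCommGroup H] [InnerProductSpace ℂ H] [CompleteSpace H]
    [TopologicalSpace.SeparableSpace H] (hdim : 2 ≤ Module.rank ℂ H)
    (Φ : UnitaryCovariance.TraceClass H →L[ℂ]
      (UnitaryCovariance.HilbertTensor H →L[ℂ] UnitaryCovariance.HilbertTensor H)) :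
    (UnitaryCovariance.IsCovariant Φ ↔
      ∃ c : Fin 6 → ℂ, ∀ X, Φ X = UnitaryCovariance.canonicalForm c X) ∧
    (3 ≤ Module.rank ℂ H → UnitaryCovariance.IsCovariant Φ →
      ∃! c : Fin 6 → ℂ, ∀ X, Φ X = UnitaryCovariance.canonicalForm c X) ∧
    (Module.rank ℂ H = 2 → UnitaryCovariance.IsCovariant Φ →
      ∃ c d : Fin 6 → ℂ, c ≠ d ∧ (∀ X, Φ X = UnitaryCovariance.canonicalForm c X) ∧
        ∀ X, Φ X = UnitaryCovariance.canonicalForm d X) := by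
  refine ⟨⟨fun h => h.exists_eq_canonicalForm hdim,
    fun ⟨c, hc⟩ => UnitaryCovariance.isCovariant_of_eq_canonicalForm hc⟩, fun h3 h => ?_,
    fun h2 h => ?_⟩
  · obtain ⟨c, hc⟩ := h.exists_eq_canonicalForm hdim
    obtain ⟨e, he⟩ := UnitaryCovariance.exists_orthonormal_of_le_rank (n := 3)
      (by exact_mod_cast h3)
    refine ⟨c, hc, fun d hd => UnitaryCovariance.contraction_injective_of_orthonormal he ?_⟩
    rw [← UnitaryCovariance.matrixElement_of_eq_canonicalForm hc,
      ← UnitaryCovariance.matrixElement_of_eq_canonicalForm hd]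
  · obtain ⟨c, hc⟩ := h.exists_eq_canonicalForm hdim
    obtain ⟨e, he⟩ := UnitaryCovariance.exists_orthonormal_of_le_rank (n := 2)
      (by exact_mod_cast hdim)
    -- The added vector is the determinant relation, whose contraction is zero in dimension two.
    refine ⟨c, c + ![-1, -1, 1, 1, 1, -1], fun hcd => ?_, hc,
      UnitaryCovariance.eq_canonicalForm_of_matrixElement fun x₁ x₂ x₃ y₁ y₂ y₃ => ?_⟩
    · have := congrFun hcd 0
      simp at this
    · have h0 := UnitaryCovariance.contraction_sign_eq_zero
        (UnitaryCovariance.exists_eq_add_of_rank_eq_two h2 he) x₁ x₂ x₃ y₁ y₂ y₃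
      rw [UnitaryCovariance.matrixElement_of_eq_canonicalForm hc]
      simp only [UnitaryCovariance.contraction, Pi.add_apply, Matrix.cons_val] at h0 ⊢
      linear_combination -h0
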